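/- Let $d\ge 1$ and let $\Delta$ be a simplicial polytopal fan in $\mathbb{R}^d$, i.e. $\Delta=\mathcal N(P_0)=\{N_F(P_0): F \text{ a non-empty face of } P_0\}$ is the normal fan of a polytope $P_0\subset\mathbb{R}^d$, where $N_F(P)=\{\mathbf{x}\in\mathbb{R}^d : \max_{\mathbf{z}\in P}\langle \mathbf{x},\mathbf{z}\rangle=\langle \mathbf{x},\mathbf{p}\rangle \text{ for all } \mathbf{p}\in F\}$, and every cone of $\Delta$ is generated by linearly independent vectors. Let $\mathcal{P}(\Delta)$ be the set of all non-empty polytopes $Q\subset\mathbb{R}^d$ whose normal fan is a coarsening of $\Delta$, i.e. every cone of $\mathcal N(Q)$ is a union of cones of $\Delta$. Write $h_Q(\mathbf{u})=\max_{\mathbf{x}\in Q}\langle \mathbf{x},\mathbf{u}\rangle$ for the support function of $Q$. Let $\mathbf{u}^{(1)},\mathbf{u}^{(2)},\ldots$ be independent random directions, each uniformly distributed on the unit sphere $\mathbb{S}^{d-1}$. For $m\ge 1$ and $\mathbf{y}=(y^{(1)},\ldots,y^{(m)})\in\mathbb{R}^m$ let $$\hat P^\Delta_m(U,\mathbf{y})=\operatorname*{argmin}_{Q\in\mathcal{P}(\Delta)}\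 \frac1m\sum_{i=1}^m\bigl(h_Q(\mathbf{u}^{(i)})-y^{(i)}\bigr)^2$$ be the set of all least-squares estimates in $\mathcal{P}(\Delta)$. Then, for every $m$, the set of outcomes for which $|\hat P^\Delta_m(U,\mathbf{y})|=1$ for all $\mathbf{y}\in\mathbb{R}^m$ is an event (i.e. measurable), and $$\lim_{m\to\infty}\mathbb{P}\Bigl(|\hat P^\Delta_m(U,\mathbf{y})|=1\ \text{ for all } \mathbf{y}\in\mathbb{R}^m\Bigr)=1 .$$ -/

import Mathlib

open MeasureTheory ProbabilityTheory Filter Topology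

noncomputable section

namespace PolytopeReconstruction

/-- Euclidean space `ℝ^d`. -/
abbrev E (d : ℕ) : Type := EuclideanSpace ℝ (Fin d)

/-- A (non-empty) polytope: a bounded non-empty intersection of finitely many half-spaces. -/
def IsPolytope {d : ℕ} (P : Set (E d)) : Prop :=
  P.Nonempty ∧ Bornology.IsBounded P ∧
    ∃ (k : ℕ) (a : Fin k → E d) (b : Fin k → ℝ), P = {x | ∀ i, inner ℝ (a i) x ≤ b i}

/-- `F` is a non-empty face of `P`: the set of maximizers over `P` of a linear functional
(the zero functional gives `P` itself). -/
def IsNonemptyFace {d : ℕ} (P F : Set (E d)) : Prop :=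
  F.Nonempty ∧ IsExposed ℝ P F

/-- The normal cone of `P` at a face `F`: all `x` such that `⟪x, ·⟫` attains its maximum over `P`
at every point of `F`. -/
def normalCone {d : ℕ} (P F : Set (E d)) : Set (E d) :=
  {x | ∀ p ∈ F, IsMaxOn (fun y => inner ℝ x y) P p}

/-- The normal fan of `P`: the collection of the normal cones at all non-empty faces. -/
def normalFan {d : ℕ} (P : Set (E d)) : Set (Set (E d)) :=
  {C | ∃ F, IsNonemptyFace P F ∧ C = normalCone P F}

/-- The cone of all non-negative linear combinations of `v 0, …, v (k - 1)`. -/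
def pos {d k : ℕ} (v : Fin k → E d) : Set (E d) :=
  {x | ∃ c : Fin k → ℝ, (∀ i, 0 ≤ c i) ∧ x = ∑ i, c i • v i}

/-- A cone is simplicial if it is generated by (finitely many) linearly independent vectors. -/
def IsSimplicialCone {d : ℕ} (C : Set (E d)) : Prop :=
  ∃ (k : ℕ) (v : Fin k → E d), LinearIndependent ℝ v ∧ C = pos v

/-- A simplicial polytopal fan: the normal fan of a polytope, all of whose cones are simplicial. -/
def IsSimplicialPolytopalFan {d : ℕ} (Δ : Set (Set (E d))) : Prop :=
  (∃ P, IsPolytope P ∧ Δ = normalFan P) ∧ ∀ C ∈ Δ, IsSimplicialCone C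

/-- `Δ` refines `Δ'` (`Δ'` coarsens `Δ`): every cone of `Δ'` is a union of cones of `Δ`. -/
def Refines {d : ℕ} (Δ Δ' : Set (Set (E d))) : Prop :=
  ∀ C ∈ Δ', ∃ S ⊆ Δ, C = ⋃₀ S

/-- The deformation cone of `Δ`: all polytopes whose normal fan is a coarsening of `Δ`. -/
def deformationCone {d : ℕ} (Δ : Set (Set (E d))) : Set (Set (E d)) :=
  {Q | IsPolytope Q ∧ Refines Δ (normalFan Q)}

/-- The support function `h_P(u) = max_{x ∈ P} ⟪u, x⟫` (the supremum is attained for a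
polytope). -/
def supportFun {d : ℕ} (P : Set (E d)) (u : E d) : ℝ :=
  sSup ((fun x => inner ℝ u x) '' P)

/-- The mean squared error of `Q` for the data `(u i, y i)`, `i = 0, …, m - 1`. -/
def meanSquaredError {d m : ℕ} (u : Fin m → E d) (y : Fin m → ℝ) (Q : Set (E d)) : ℝ :=
  (1 / (m : ℝ)) * ∑ i, (supportFun Q (u i) - y i) ^ 2

/-- The least-squares estimator: the set of all polytopes in the deformation cone of `Δ` that
minimize the mean squared error over the deformation cone. -/
def leastSquares {d m : ℕ} (Δ : Set (Set (E d))) (u : Fin m → E d) (y : Fin m → ℝ) :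
    Set (Set (E d)) :=
  {Q ∈ deformationCone Δ | IsMinOn (meanSquaredError u y) (deformationCone Δ) Q}

/-- The uniform probability measure on the unit sphere of `ℝ^d`, i.e. the surface measure
normalized to total mass one. -/
def sphereUniform (d : ℕ) : Measure (Metric.sphere (0 : E d) 1) :=
  ((volume : Measure (E d)).toSphere Set.univ)⁻¹ • (volume : Measure (E d)).toSphere

/-- The event that the reconstruction from the first `m` directions of the sequence `u` is unique
for every vector `y` of support function evaluations. -/
def uniqueEvent {d : ℕ} (Δ : Set (Set (E d))) {Ω : Type*}
    (u : ℕ → Ω → Metric.sphere (0 : E d) 1) (m : ℕ) : Set Ω :=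
  {ω | ∀ y : Fin m → ℝ, (leastSquares Δ (fun i : Fin m => (u i ω : E d)) y).encard = 1}

end PolytopeReconstruction

end

open PolytopeReconstruction

namespace PolytopeReconstruction

/-! Passing to support functions turns the deformation cone of the normal fan of `P` into a closed
convex cone `typeCone P` of sublinear functions, additive on the cones of the fan
(`supportFun_mem_typeCone`, `exists_supportFun_eq`). Such functions are determined by their values
on finitely many ray generators, so their span `typeSpace P` is finite-dimensional.

Least squares now means projecting `y` onto the image of this cone under evaluation at the
directions. If evaluation is injective on the span, the image is closed and convex, so the
projection exists and comes from one polytope. If it is not, two distinct polytopes share all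
measurements and both fit them exactly. Hence uniqueness for all `y` is injectivity of `evalAt`
(`forall_encard_leastSquares_eq_one_iff`), an event that is measurable and increasing in `m`.

Independent uniform directions are almost surely dense in the sphere. The decreasing kernels of
evaluation stabilize, and a function in the stable kernel vanishes on a dense set, hence everywhere
by continuity and homogeneity. So injectivity almost surely occurs at some finite `m`, and
continuity from below gives the limit. -/

variable {d : ℕ}

/-! ### Faces, normal cones and support functions -/

/-- The set of maximizers of `⟪x, ·⟫` over `P`. -/
def maxFace (P : Set (E d)) (x : E d) : Set (E d) :=
  {p ∈ P | IsMaxOn (fun y => inner ℝ x y) P p}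

theorem IsPolytope.isClosed {P : Set (E d)} (hP : IsPolytope P) : IsClosed P := by
  obtain ⟨-, -, k, a, b, rfl⟩ := hP
  simp only [Set.ofPred_forall]
  exact isClosed_iInter fun i => isClosed_le (by fun_prop) continuous_const

theorem IsPolytope.isCompact {P : Set (E d)} (hP : IsPolytope P) : IsCompact P :=
  Metric.isCompact_of_isClosed_isBounded hP.isClosed hP.2.1

theorem IsPolytope.convex {P : Set (E d)} (hP : IsPolytope P) : Convex ℝ P := by
  obtain ⟨-, -, k, a, b, rfl⟩ := hP
  simp only [Set.ofPred_forall]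
  exact convex_iInter fun i => convex_halfSpace_le (innerₛₗ ℝ (a i)).isLinear (b i)

theorem inner_le_supportFun {P : Set (E d)} (hP : IsCompact P) (x : E d) {p : E d} (hp : p ∈ P) :
    inner ℝ x p ≤ supportFun P x :=
  le_csSup (hP.image (by fun_prop : Continuous fun y : E d => inner ℝ x y)).bddAbove
    (Set.mem_image_of_mem _ hp)

theorem mem_maxFace {P : Set (E d)} (hP : IsCompact P) {x p : E d} :
    p ∈ maxFace P x ↔ p ∈ P ∧ inner ℝ x p = supportFun P x := by
  refine and_congr_right fun hp => ⟨fun h => ?_, fun h q hq => ?_⟩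
  · refine le_antisymm (inner_le_supportFun hP x hp) (csSup_le ⟨_, Set.mem_image_of_mem _ hp⟩ ?_)
    rintro _ ⟨q, hq, rfl⟩
    exact h hq
  · simpa [h] using inner_le_supportFun hP x hq

theorem maxFace_nonempty {P : Set (E d)} (hP : IsCompact P) (hne : P.Nonempty) (x : E d) :
    (maxFace P x).Nonempty := by
  obtain ⟨p, hp, h⟩ := hP.exists_isMaxOn hne
    (by fun_prop : Continuous fun y : E d => inner ℝ x y).continuousOn
  exact ⟨p, hp, h⟩

theorem mem_normalCone_maxFace {P : Set (E d)} {x y : E d} :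
    y ∈ normalCone P (maxFace P x) ↔ maxFace P x ⊆ maxFace P y :=
  ⟨fun h p hp => ⟨hp.1, h p hp⟩, fun h _ hp => (h hp).2⟩

theorem isNonemptyFace_iff {P F : Set (E d)} (hP : IsCompact P) (hne : P.Nonempty) :
    IsNonemptyFace P F ↔ ∃ x, F = maxFace P x := by
  constructor
  · rintro ⟨hF, hexp⟩
    obtain ⟨l, rfl⟩ := hexp hF
    refine ⟨(InnerProductSpace.toDual ℝ (E d)).symm l, ?_⟩
    simp only [maxFace, InnerProductSpace.toDual_symm_apply]
    rfl
  · rintro ⟨x, rfl⟩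
    exact ⟨maxFace_nonempty hP hne x, fun _ => ⟨innerSL ℝ x, rfl⟩⟩

theorem mem_normalFan_iff {P C : Set (E d)} (hP : IsCompact P) (hne : P.Nonempty) :
    C ∈ normalFan P ↔ ∃ x, C = {y | maxFace P x ⊆ maxFace P y} := by
  have key (x : E d) : normalCone P (maxFace P x) = {y | maxFace P x ⊆ maxFace P y} :=
    Set.ext fun y => mem_normalCone_maxFace
  constructor
  · rintro ⟨F, hF, rfl⟩
    obtain ⟨x, rfl⟩ := (isNonemptyFace_iff hP hne).1 hF
    exact ⟨x, key x⟩
  · rintro ⟨x, rfl⟩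
    exact ⟨_, (isNonemptyFace_iff hP hne).2 ⟨x, rfl⟩, (key x).symm⟩

/-- Replaces unions of cones by an implication between maximizing faces, the form in which
coarsening is used from here on. -/
theorem refines_normalFan_iff {P Q : Set (E d)} (hP : IsCompact P) (hPne : P.Nonempty)
    (hQ : IsCompact Q) (hQne : Q.Nonempty) :
    Refines (normalFan P) (normalFan Q) ↔
      ∀ x y, maxFace P x ⊆ maxFace P y → maxFace Q x ⊆ maxFace Q y := by
  constructor
  · intro h x y hxy
    obtain ⟨S, hS, hU⟩ := h _ ((mem_normalFan_iff hQ hQne).2 ⟨x, rfl⟩)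
    have hx : x ∈ ⋃₀ S := hU ▸ (subset_rfl : maxFace Q x ⊆ maxFace Q x)
    obtain ⟨C, hCS, hxC⟩ := hx
    obtain ⟨z, rfl⟩ := (mem_normalFan_iff hP hPne).1 (hS hCS)
    have hy : y ∈ ⋃₀ S := ⟨_, hCS, Set.Subset.trans hxC hxy⟩
    rw [← hU] at hy
    exact hy
  · intro h C hC
    obtain ⟨g, rfl⟩ := (mem_normalFan_iff hQ hQne).1 hC
    -- The cone of `Q` at `g` is covered by the cones of `P` around each of its own points.
    refine ⟨{D | ∃ x, maxFace Q g ⊆ maxFace Q x ∧ D = {y | maxFace P x ⊆ maxFace P y}}, ?_, ?_⟩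
    · rintro D ⟨x, -, rfl⟩
      exact (mem_normalFan_iff hP hPne).2 ⟨x, rfl⟩
    · ext y
      constructor
      · intro hy
        exact ⟨_, ⟨y, hy, rfl⟩, (subset_rfl : maxFace P y ⊆ maxFace P y)⟩
      · rintro ⟨_, ⟨x, hx, rfl⟩, hy⟩
        exact hx.trans (h x y hy)

theorem supportFun_smul {P : Set (E d)} (hP : IsCompact P) (hne : P.Nonempty) {c : ℝ}
    (hc : 0 ≤ c) (x : E d) : supportFun P (c • x) = c * supportFun P x := by
  obtain ⟨p, hp⟩ := maxFace_nonempty hP hne x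
  obtain ⟨q, hq⟩ := maxFace_nonempty hP hne (c • x)
  rw [mem_maxFace hP] at hp hq
  have h1 := inner_le_supportFun hP (c • x) hp.1
  have h2 := mul_le_mul_of_nonneg_left (inner_le_supportFun hP x hq.1) hc
  rw [real_inner_smul_left, hp.2] at h1
  rw [real_inner_smul_left] at hq
  linarith [hq.2]

theorem supportFun_add_le {P : Set (E d)} (hP : IsCompact P) (hne : P.Nonempty) (x y : E d) :
    supportFun P (x + y) ≤ supportFun P x + supportFun P y := by
  obtain ⟨p, hp⟩ := maxFace_nonempty hP hne (x + y)
  rw [mem_maxFace hP, inner_add_left] at hp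
  linarith [inner_le_supportFun hP x hp.1, inner_le_supportFun hP y hp.1]

theorem supportFun_add_of_mem {P : Set (E d)} (hP : IsCompact P) {x y p : E d}
    (hx : p ∈ maxFace P x) (hy : p ∈ maxFace P y) :
    supportFun P (x + y) = supportFun P x + supportFun P y := by
  have h := inner_le_supportFun hP (x + y) hx.1
  have h' := supportFun_add_le hP ⟨p, hx.1⟩ x y
  rw [mem_maxFace hP] at hx hy
  rw [inner_add_left] at h
  linarith [hx.2, hy.2]

theorem maxFace_inter_subset {P : Set (E d)} (x y : E d) :
    maxFace P x ∩ maxFace P y ⊆ maxFace P (x + y) := by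
  rintro p ⟨hx, hy⟩
  refine ⟨hx.1, fun q hq => ?_⟩
  have h1 := hx.2 hq
  have h2 := hy.2 hq
  simp only [Set.mem_ofPred_eq, inner_add_left] at h1 h2 ⊢
  exact add_le_add h1 h2

/-- With a common maximizer the maximum of the sum is the sum of the maxima, so attaining it forces
both summands to be maximal. -/
theorem maxFace_add_subset {P : Set (E d)} (hP : IsCompact P) {x y : E d}
    (h : (maxFace P x ∩ maxFace P y).Nonempty) : maxFace P (x + y) ⊆ maxFace P x := by
  obtain ⟨p, hx, hy⟩ := h
  intro q hq
  have := supportFun_add_of_mem hP hx hy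
  rw [mem_maxFace hP] at hq ⊢
  have h1 := inner_le_supportFun hP x hq.1
  have h2 := inner_le_supportFun hP y hq.1
  have h3 := hq.2
  rw [inner_add_left] at h3
  exact ⟨hq.1, by linarith⟩

/-- A polytope is determined by its support function. -/
theorem IsPolytope.eq_setOf_inner_le_supportFun {P : Set (E d)} (hP : IsPolytope P) :
    P = {x | ∀ u, inner ℝ u x ≤ supportFun P u} := by
  refine Set.Subset.antisymm (fun x hx u => inner_le_supportFun hP.isCompact u hx) fun x hx => ?_
  obtain ⟨hne, -, k, a, b, h⟩ := hP
  rw [h]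
  intro i
  refine (hx (a i)).trans (csSup_le (hne.image _) ?_)
  rintro _ ⟨p, hp, rfl⟩
  rw [h] at hp
  exact hp i

/-! ### Vertices and finiteness of the normal fan -/

/-- An extreme point is determined by its set of active constraints: if `y` has the same ones, the
segment from `y` to `x` can be prolonged slightly beyond `x`, contradicting extremality of `x`
unless `x = y`. -/
theorem finite_extremePoints_of_halfSpaces {k : ℕ} (a : Fin k → E d) (b : Fin k → ℝ) :
    (Set.extremePoints ℝ {x | ∀ i, inner ℝ (a i) x ≤ b i}).Finite := by
  refine Set.Finite.of_injOn (f := fun x => {i | inner ℝ (a i) x = b i})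
    (t := Set.univ) (fun _ _ => Set.mem_univ _) ?_ Set.finite_univ
  intro x hx y hy hxy
  simp only [Set.ext_iff, Set.mem_ofPred_eq] at hxy
  have hev : ∀ᶠ t in 𝓝[>] (0 : ℝ), ∀ i,
      inner ℝ (a i) x + t * (inner ℝ (a i) x - inner ℝ (a i) y) ≤ b i := by
    rw [eventually_all]
    intro i
    by_cases hi : inner ℝ (a i) x = b i
    · refine Eventually.of_forall fun t => ?_
      rw [hi, (hxy i).1 hi]
      simp
    · have hlt : inner ℝ (a i) x + 0 * (inner ℝ (a i) x - inner ℝ (a i) y) < b i := by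
        simpa using lt_of_le_of_ne (hx.1 i) hi
      have hcont : Continuous fun t : ℝ =>
          inner ℝ (a i) x + t * (inner ℝ (a i) x - inner ℝ (a i) y) := by fun_prop
      exact ((hcont.tendsto 0).eventually_lt_const hlt).filter_mono nhdsWithin_le_nhds
        |>.mono fun t ht => ht.le
  obtain ⟨t, ht, htpos⟩ := (hev.and self_mem_nhdsWithin).exists
  have htpos : 0 < t := htpos
  have hz : x + t • (x - y) ∈ {x | ∀ i, inner ℝ (a i) x ≤ b i} := fun i => by
    simpa [inner_add_right, inner_sub_right, inner_smul_right] using ht i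
  have hseg : x ∈ openSegment ℝ y (x + t • (x - y)) := by
    refine ⟨t / (1 + t), 1 / (1 + t), by positivity, by positivity, by field_simp; ring, ?_⟩
    have h1 : (1 + t) ≠ 0 := by positivity
    rw [← sub_eq_zero]
    have : (t / (1 + t)) • y + (1 / (1 + t)) • (x + t • (x - y)) - x
        = (t / (1 + t) - 1 / (1 + t) * t) • y + (1 / (1 + t) * (1 + t) - 1) • x := by module
    rw [this, one_div_mul_cancel h1, div_eq_mul_one_div, mul_comm t]
    simp
  exact (hx.2 hy.1 hz hseg).symm

theorem IsPolytope.exists_finite_convexHull {P : Set (E d)} (hP : IsPolytope P) :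
    ∃ V : Set (E d), V.Finite ∧ convexHull ℝ V = P := by
  have hfin : (P.extremePoints ℝ).Finite := by
    obtain ⟨-, -, k, a, b, rfl⟩ := hP
    exact finite_extremePoints_of_halfSpaces a b
  refine ⟨P.extremePoints ℝ, hfin, ?_⟩
  rw [← hfin.isClosed_convexHull (𝕜 := ℝ) |>.closure_eq]
  exact closure_convexHull_extremePoints hP.isCompact hP.convex

/-- If every vertex maximizing `x` maximizes `y`, then the deficit of `y` over the polytope is
bounded by a multiple of the deficit of `x`. -/
theorem exists_deficit_le {P V : Set (E d)} (hP : IsCompact P) (hV : V.Finite)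
    (hVP : convexHull ℝ V = P) {x y : E d} (h : V ∩ maxFace P x ⊆ maxFace P y) :
    ∃ L : ℝ, 0 ≤ L ∧ ∀ q ∈ P,
      supportFun P y - inner ℝ y q ≤ L * (supportFun P x - inner ℝ x q) := by
  have hsub : V ⊆ P := hVP ▸ subset_convexHull ℝ V
  -- Any larger constant also works at `v`, so a single one serves all of the finite set `V`; the
  -- bound is affine in `q` and passes to the convex hull.
  have hpt : ∀ v ∈ V, ∃ l : ℝ, ∀ L, l ≤ L →
      supportFun P y - inner ℝ y v ≤ L * (supportFun P x - inner ℝ x v) := by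
    intro v hv
    by_cases hx : v ∈ maxFace P x
    · have hy := ((mem_maxFace hP).1 (h ⟨hv, hx⟩)).2
      have hx := ((mem_maxFace hP).1 hx).2
      exact ⟨0, fun L _ => by simp [hx, hy]⟩
    · have hpos : 0 < supportFun P x - inner ℝ x v := by
        rw [mem_maxFace hP] at hx
        exact sub_pos.2 (lt_of_le_of_ne (inner_le_supportFun hP x (hsub hv))
          fun he => hx ⟨hsub hv, he⟩)
      exact ⟨(supportFun P y - inner ℝ y v) / (supportFun P x - inner ℝ x v),
        fun L hL => (div_le_iff₀ hpos).1 hL⟩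
  choose! l hl using hpt
  obtain ⟨M, hM⟩ := (hV.image l).bddAbove
  refine ⟨max M 0, le_max_right _ _, fun q hq => ?_⟩
  have hconv : Convex ℝ {q : E d | inner ℝ (max M 0 • x - y) q ≤
      max M 0 * supportFun P x - supportFun P y} :=
    convex_halfSpace_le (innerₛₗ ℝ (max M 0 • x - y)).isLinear _
  have hVsub : V ⊆ {q : E d | inner ℝ (max M 0 • x - y) q ≤
      max M 0 * supportFun P x - supportFun P y} := by
    intro v hv
    have := hl v hv _ ((hM (Set.mem_image_of_mem l hv)).trans (le_max_left M 0))
    simp only [Set.mem_ofPred_eq, inner_sub_left, real_inner_smul_left]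
    linarith
  have := convexHull_min hVsub hconv (hVP.symm ▸ hq)
  simp only [Set.mem_ofPred_eq, inner_sub_left, real_inner_smul_left] at this
  linarith

theorem maxFace_subset_of_deficit_le {P : Set (E d)} (hP : IsCompact P) {x y : E d} {L : ℝ}
    (h : ∀ q ∈ P, supportFun P y - inner ℝ y q ≤ L * (supportFun P x - inner ℝ x q)) :
    maxFace P x ⊆ maxFace P y := by
  intro q hq
  rw [mem_maxFace hP] at hq ⊢
  have h1 := h q hq.1
  rw [hq.2, sub_self, mul_zero] at h1
  exact ⟨hq.1, le_antisymm (inner_le_supportFun hP y hq.1) (by linarith)⟩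

/-- A cone depends only on which points of the finite generating set lie in the maximizing face. -/
theorem finite_normalFan {P : Set (E d)} (hP : IsPolytope P) : (normalFan P).Finite := by
  obtain ⟨V, hV, hVP⟩ := hP.exists_finite_convexHull
  have hc := hP.isCompact
  refine (hV.powerset.image fun S => {y | S ⊆ maxFace P y}).subset fun C hC => ?_
  obtain ⟨x, rfl⟩ := (mem_normalFan_iff hc hP.1).1 hC
  refine ⟨V ∩ maxFace P x, Set.inter_subset_left, Set.ext fun y => ⟨fun h => ?_, fun h => ?_⟩⟩
  · obtain ⟨L, -, hL⟩ := exists_deficit_le hc hV hVP h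
    exact maxFace_subset_of_deficit_le hc hL
  · exact Set.inter_subset_right.trans h

/-- A direction can be moved slightly away from any direction in its normal cone without
leaving the relative interior of that cone. -/
theorem IsPolytope.exists_maxFace_sub_smul {P : Set (E d)} (hP : IsPolytope P) {x y : E d}
    (h : maxFace P x ⊆ maxFace P y) :
    ∃ ε : ℝ, 0 < ε ∧ maxFace P (x - ε • y) ⊆ maxFace P y := by
  obtain ⟨V, hV, hVP⟩ := hP.exists_finite_convexHull
  have hc := hP.isCompact
  obtain ⟨L, hL0, hL⟩ := exists_deficit_le hc hV hVP (Set.inter_subset_right.trans h)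
  -- This `ε` makes `ε * L < 1`: subtracting `ε • y` then cannot offset the deficit of `x`, so
  -- maximizers of `x - ε • y` still maximize `x`.
  have hε : (0 : ℝ) < 1 / (L + 1) := by positivity
  have hεL : 0 < 1 - 1 / (L + 1) * L := by
    have : 1 - 1 / (L + 1) * L = 1 / (L + 1) := by field_simp; ring
    rw [this]; exact hε
  refine ⟨1 / (L + 1), hε, fun q hq => ?_⟩
  set ε := 1 / (L + 1)
  obtain ⟨p, hp⟩ := maxFace_nonempty hc hP.1 x
  have hpx := ((mem_maxFace hc).1 hp).2
  have hpy := ((mem_maxFace hc).1 (h hp)).2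
  refine h ((mem_maxFace hc).2 ⟨hq.1, le_antisymm (inner_le_supportFun hc x hq.1) ?_⟩)
  have h1 := hq.2 hp.1
  simp only [Set.mem_ofPred_eq, inner_sub_left, real_inner_smul_left] at h1
  have h2 := mul_le_mul_of_nonneg_left (hL q hq.1) hε.le
  have h3 : (1 - ε * L) * (supportFun P x - inner ℝ x q) ≤ 0 := by
    rw [hpx, hpy] at h1
    nlinarith
  nlinarith [nonpos_of_mul_nonpos_right h3 hεL]

/-! ### The type cone and the rays of the fan -/

/-- The cone of support functions attached to the normal fan of `P`: sublinear functions that are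
additive on the cones of the fan. -/
def typeCone (P : Set (E d)) : Set (E d → ℝ) :=
  {h | (∀ c : ℝ, 0 ≤ c → ∀ x, h (c • x) = c * h x) ∧ (∀ x y, h (x + y) ≤ h x + h y) ∧
    ∀ x y, maxFace P x ⊆ maxFace P y → h (x + y) = h x + h y}

theorem isClosed_typeCone (P : Set (E d)) : IsClosed (typeCone P) := by
  simp only [typeCone, Set.ofPred_and, Set.ofPred_forall]
  refine IsClosed.inter ?_ (IsClosed.inter ?_ ?_)
  · exact isClosed_iInter fun c => isClosed_iInter fun _ => isClosed_iInter fun x =>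
      isClosed_eq (by fun_prop) (by fun_prop)
  · exact isClosed_iInter fun x => isClosed_iInter fun y =>
      isClosed_le (by fun_prop) (by fun_prop)
  · exact isClosed_iInter fun x => isClosed_iInter fun y => isClosed_iInter fun _ =>
      isClosed_eq (by fun_prop) (by fun_prop)

theorem zero_mem_typeCone (P : Set (E d)) : (0 : E d → ℝ) ∈ typeCone P := by
  simp [typeCone]

theorem add_mem_typeCone {P : Set (E d)} {g h : E d → ℝ} (hg : g ∈ typeCone P)
    (hh : h ∈ typeCone P) : g + h ∈ typeCone P := by
  refine ⟨fun c hc x => ?_, fun x y => ?_, fun x y hxy => ?_⟩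
  · simp [hg.1 c hc, hh.1 c hc, mul_add]
  · simp only [Pi.add_apply]; linarith [hg.2.1 x y, hh.2.1 x y]
  · simp only [Pi.add_apply]; linarith [hg.2.2 x y hxy, hh.2.2 x y hxy]

theorem smul_mem_typeCone {P : Set (E d)} {h : E d → ℝ} (hh : h ∈ typeCone P) {r : ℝ}
    (hr : 0 ≤ r) : r • h ∈ typeCone P := by
  refine ⟨fun c hc x => ?_, fun x y => ?_, fun x y hxy => ?_⟩
  · simp only [Pi.smul_apply, smul_eq_mul, hh.1 c hc]; ring
  · simp only [Pi.smul_apply, smul_eq_mul, ← mul_add]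
    exact mul_le_mul_of_nonneg_left (hh.2.1 x y) hr
  · simp only [Pi.smul_apply, smul_eq_mul, hh.2.2 x y hxy, mul_add]

theorem convex_typeCone (P : Set (E d)) : Convex ℝ (typeCone P) :=
  fun _ hg _ hh _ _ ha hb _ => add_mem_typeCone (smul_mem_typeCone hg ha) (smul_mem_typeCone hh hb)

theorem continuous_of_mem_typeCone {P : Set (E d)} {h : E d → ℝ} (hh : h ∈ typeCone P) :
    Continuous h := by
  have hconv : ConvexOn ℝ Set.univ h :=
    ⟨convex_univ, fun x _ y _ a b ha hb _ => by
      simpa [hh.1 a ha, hh.1 b hb] using hh.2.1 (a • x) (b • y)⟩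
  exact continuousOn_univ.1 (hconv.continuousOn isOpen_univ)

/-- By refinement a maximizer of `x` over `Q` also maximizes `y`, and a common maximizer makes the
support function additive. -/
theorem supportFun_mem_typeCone {P Q : Set (E d)} (hP : IsPolytope P)
    (hQ : Q ∈ deformationCone (normalFan P)) : supportFun Q ∈ typeCone P := by
  have hc := hQ.1.isCompact
  have href := (refines_normalFan_iff hP.isCompact hP.1 hc hQ.1.1).1 hQ.2
  refine ⟨fun c hc0 x => supportFun_smul hc hQ.1.1 hc0 x, supportFun_add_le hc hQ.1.1,
    fun x y hxy => ?_⟩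
  obtain ⟨p, hp⟩ := maxFace_nonempty hc hQ.1.1 x
  exact supportFun_add_of_mem hc hp (href x y hxy hp)

/-- Functions in the type cone are additive on every cone of the normal fan. -/
theorem add_of_mem_normalFan {P : Set (E d)} (hP : IsPolytope P) {h : E d → ℝ}
    (hh : h ∈ typeCone P) {C : Set (E d)} (hC : C ∈ normalFan P) {u v : E d} (hu : u ∈ C)
    (hv : v ∈ C) : u + v ∈ C ∧ h (u + v) = h u + h v := by
  have hc := hP.isCompact
  obtain ⟨z, rfl⟩ := (mem_normalFan_iff hc hP.1).1 hC
  have hu : maxFace P z ⊆ maxFace P u := hu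
  have hv : maxFace P z ⊆ maxFace P v := hv
  have huv : maxFace P z ⊆ maxFace P (u + v) :=
    (Set.subset_inter hu hv).trans (maxFace_inter_subset u v)
  obtain ⟨p, hp⟩ := maxFace_nonempty hc hP.1 z
  have hzu : maxFace P (z + u) ⊆ maxFace P z := maxFace_add_subset hc ⟨p, hp, hu hp⟩
  -- Additivity is only given for nested faces, so `h (z + u + v)` is expanded in two ways from the
  -- relative interior point `z`, and `h z` is cancelled.
  have h1 := hh.2.2 z (u + v) huv
  have h2 := hh.2.2 z u hu
  have h3 := hh.2.2 (z + u) v (hzu.trans hv)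
  rw [add_assoc] at h3
  exact ⟨huv, by linarith⟩

theorem zero_mem_of_mem_normalFan {P : Set (E d)} {C : Set (E d)} (hC : C ∈ normalFan P) :
    (0 : E d) ∈ C := by
  obtain ⟨F, -, rfl⟩ := hC
  intro p _ q _
  simp

theorem smul_mem_of_mem_normalFan {P : Set (E d)} {C : Set (E d)} (hC : C ∈ normalFan P)
    {c : ℝ} (hc : 0 ≤ c) {u : E d} (hu : u ∈ C) : c • u ∈ C := by
  obtain ⟨F, -, rfl⟩ := hC
  intro p hp q hq
  simpa [real_inner_smul_left] using mul_le_mul_of_nonneg_left (hu p hp hq) hc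

theorem sum_of_mem_normalFan {P : Set (E d)} (hP : IsPolytope P) {h : E d → ℝ}
    (hh : h ∈ typeCone P) {C : Set (E d)} (hC : C ∈ normalFan P) {ι : Type*} (s : Finset ι)
    {v : ι → E d} (hv : ∀ i, v i ∈ C) {c : ι → ℝ} (hcn : ∀ i, 0 ≤ c i) :
    ∑ i ∈ s, c i • v i ∈ C ∧ h (∑ i ∈ s, c i • v i) = ∑ i ∈ s, c i * h (v i) := by
  classical
  induction s using Finset.induction_on with
  | empty =>
    have := hh.1 0 le_rfl 0
    simp only [zero_smul, zero_mul] at this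
    simp [zero_mem_of_mem_normalFan hC, this]
  | insert i s hi ih =>
    have := add_of_mem_normalFan hP hh hC (smul_mem_of_mem_normalFan hC (hcn i) (hv i)) ih.1
    rw [Finset.sum_insert hi, Finset.sum_insert hi, this.2, ih.2, hh.1 _ (hcn i)]
    exact ⟨this.1, rfl⟩

/-- The rays of a simplicial polytopal fan: finitely many vectors such that every vector is a
non-negative combination of them along which all functions in the type cone are linear. -/
theorem exists_rays {P : Set (E d)} (hP : IsPolytope P)
    (hS : ∀ C ∈ normalFan P, IsSimplicialCone C) :
    ∃ R : Finset (E d), ∀ u : E d, ∃ (k : ℕ) (v : Fin k → E d) (c : Fin k → ℝ),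
      (∀ i, v i ∈ R) ∧ (∀ i, 0 ≤ c i) ∧ u = ∑ i, c i • v i ∧
      ∀ h ∈ typeCone P, h u = ∑ i, c i * h (v i) := by
  choose! k v hv hpos using hS
  have hfin : (⋃ C ∈ normalFan P, Set.range (v C)).Finite :=
    (finite_normalFan hP).biUnion fun C _ => Set.finite_range _
  refine ⟨hfin.toFinset, fun u => ?_⟩
  have hC : {y | maxFace P u ⊆ maxFace P y} ∈ normalFan P :=
    (mem_normalFan_iff hP.isCompact hP.1).2 ⟨u, rfl⟩
  set C := {y | maxFace P u ⊆ maxFace P y}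
  have huC : u ∈ pos (v C) := by
    rw [← hpos C hC]; exact (subset_rfl : maxFace P u ⊆ maxFace P u)
  obtain ⟨c, hc, hu⟩ := huC
  refine ⟨k C, v C, c, fun i => ?_, hc, hu, fun h hh => ?_⟩
  · simp only [Set.Finite.mem_toFinset, Set.mem_iUnion]
    exact ⟨C, hC, i, rfl⟩
  · have hvC : ∀ i, v C i ∈ C := fun i => by
      refine (hpos C hC).ge ⟨Pi.single i 1, fun j => by
        by_cases hj : j = i
        · subst hj; simp
        · simp [hj], by simp [Pi.single_apply]⟩
    conv_lhs => rw [hu]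
    exact (sum_of_mem_normalFan hP hh hC Finset.univ hvC hc).2

/-! ### From the type cone back to polytopes -/

/-- A sublinear function is attained by linear functionals below it. -/
theorem exists_inner_eq_of_sublinear {h : E d → ℝ} (hom : ∀ c : ℝ, 0 ≤ c → ∀ x, h (c • x) = c * h x)
    (hadd : ∀ x y, h (x + y) ≤ h x + h y) (u : E d) :
    ∃ x : E d, (∀ v, inner ℝ v x ≤ h v) ∧ inner ℝ u x = h u := by
  have h0 : h 0 = 0 := by simpa using hom 0 le_rfl 0
  have hneg (w : E d) : -h w ≤ h (-w) := by
    have := hadd w (-w)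
    rw [add_neg_cancel, h0] at this
    linarith
  have hwd (c : ℝ) (hc : c • u = 0) : c • h u = 0 := by
    rcases smul_eq_zero.1 hc with rfl | rfl
    · simp
    · simp [h0]
  -- Hahn–Banach for the functional `c • u ↦ c * h u`; domination at negative `c` comes from `hneg`.
  obtain ⟨g, hgf, hg⟩ := exists_extension_of_le_sublinear
    (LinearPMap.mkSpanSingleton' (σ := RingHom.id ℝ) u (h u) hwd) h (fun c hc => hom c hc.le) hadd (by
      rintro ⟨x, hx⟩
      obtain ⟨c, rfl⟩ := Submodule.mem_span_singleton.1 hx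
      rw [LinearPMap.mkSpanSingleton'_apply]
      simp only [smul_eq_mul, RingHom.id_apply]
      rcases le_total 0 c with hc | hc
      · rw [hom c hc]
      · have h1 := hom (-c) (by linarith) u
        have h2 := hneg ((-c) • u)
        simp only [neg_smul, neg_neg] at h1 h2
        linarith)
  refine ⟨(InnerProductSpace.toDual ℝ (E d)).symm g.toContinuousLinearMap, fun v => ?_, ?_⟩
  · rw [real_inner_comm, InnerProductSpace.toDual_symm_apply]
    exact hg v
  · rw [real_inner_comm, InnerProductSpace.toDual_symm_apply]
    have hu : u ∈ (LinearPMap.mkSpanSingleton' (σ := RingHom.id ℝ) u (h u) hwd).domain :=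
      Submodule.mem_span_singleton_self u
    exact (hgf ⟨u, hu⟩).trans (LinearPMap.mkSpanSingleton'_apply_self (σ := RingHom.id ℝ) u (h u) hwd hu)

/-- Every function in the type cone is the support function of a polytope in the deformation
cone. -/
theorem exists_supportFun_eq {P : Set (E d)} (hP : IsPolytope P)
    (hS : ∀ C ∈ normalFan P, IsSimplicialCone C) {h : E d → ℝ} (hh : h ∈ typeCone P) :
    ∃ Q ∈ deformationCone (normalFan P), supportFun Q = h := by
  set Q : Set (E d) := {x | ∀ u, inner ℝ u x ≤ h u}
  have hatt := exists_inner_eq_of_sublinear hh.1 hh.2.1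
  have hne : Q.Nonempty := let ⟨x, hx, _⟩ := hatt 0; ⟨x, hx⟩
  have hsupp : supportFun Q = h := by
    funext u
    obtain ⟨x, hx, hxu⟩ := hatt u
    refine le_antisymm (csSup_le (hne.image _) ?_) ?_
    · rintro _ ⟨q, hq, rfl⟩
      exact hq u
    · rw [← hxu]
      refine le_csSup ⟨h u, ?_⟩ ⟨x, hx, rfl⟩
      rintro _ ⟨q, hq, rfl⟩
      exact hq u
  have hbdd : Bornology.IsBounded Q := by
    obtain ⟨M, hM⟩ := (isCompact_sphere (0 : E d) 1).bddAbove_image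
      (continuous_of_mem_typeCone hh).continuousOn
    refine (Metric.isBounded_closedBall (x := (0 : E d)) (r := max M 0)).subset fun x hx => ?_
    rw [mem_closedBall_zero_iff]
    by_cases hx0 : x = 0
    · simp [hx0]
    · have hn : ‖x‖ ≠ 0 := norm_ne_zero_iff.2 hx0
      have h1 := hx (‖x‖⁻¹ • x)
      have h2 := hM ⟨‖x‖⁻¹ • x, by simp [norm_smul, hn], rfl⟩
      rw [real_inner_smul_left, real_inner_self_eq_norm_sq, pow_two, inv_mul_cancel_left₀ hn] at h1
      exact (h1.trans h2).trans (le_max_left _ _)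
  have hpoly : IsPolytope Q := by
    obtain ⟨R, hR⟩ := exists_rays hP hS
    refine ⟨hne, hbdd, R.card, fun i => (R.equivFin.symm i : E d),
      fun i => h (R.equivFin.symm i : E d), ?_⟩
    -- The inequalities at the finitely many rays imply all others, since `h` is linear along the
    -- ray expansion of each `u`.
    refine Set.Subset.antisymm (fun x hx i => hx _) fun x hx u => ?_
    obtain ⟨k, v, c, hv, hc, hu, hlin⟩ := hR u
    rw [hlin h hh, hu, sum_inner]
    refine Finset.sum_le_sum fun i _ => ?_
    rw [real_inner_smul_left]
    have := hx (R.equivFin ⟨v i, hv i⟩)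
    simp only [Equiv.symm_apply_apply] at this
    exact mul_le_mul_of_nonneg_left this (hc i)
  refine ⟨Q, ⟨hpoly, ?_⟩, hsupp⟩
  have hQc := hpoly.isCompact
  refine (refines_normalFan_iff hP.isCompact hP.1 hQc hne).2 fun x y hxy p hp => ?_
  -- Splitting `h x = h (x - ε • y) + ε * h y`, a maximizer of `x` over `Q` must attain both terms,
  -- in particular the one for `y`.
  obtain ⟨ε, hε, hsub⟩ := hP.exists_maxFace_sub_smul hxy
  rw [mem_maxFace hQc, hsupp] at hp ⊢
  have hsub' : maxFace P (x - ε • y) ⊆ maxFace P (ε • y) := by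
    intro q hq
    have := (hsub hq).2
    refine ⟨hq.1, fun r hr => ?_⟩
    have := this hr
    simp only [Set.mem_ofPred_eq, real_inner_smul_left] at this ⊢
    exact mul_le_mul_of_nonneg_left this hε.le
  have h1 := hh.2.2 _ _ hsub'
  rw [sub_add_cancel, hh.1 ε hε.le] at h1
  have h2 := hp.1 (x - ε • y)
  have h3 := hp.1 y
  rw [inner_sub_left, real_inner_smul_left] at h2
  refine ⟨hp.1, le_antisymm h3 ?_⟩
  have : ε * h y ≤ ε * inner ℝ y p := by linarith [hp.2]
  exact le_of_mul_le_mul_left this hε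

/-! ### The linear span and evaluation at directions -/

/-- Differences of functions in the type cone. -/
def typeSpace (P : Set (E d)) : Submodule ℝ (E d → ℝ) := Submodule.span ℝ (typeCone P)

theorem exists_sub_of_mem_typeSpace {P : Set (E d)} {f : E d → ℝ} (hf : f ∈ typeSpace P) :
    ∃ g ∈ typeCone P, ∃ h ∈ typeCone P, f = g - h := by
  induction hf using Submodule.span_induction with
  | mem f hf => exact ⟨f, hf, 0, zero_mem_typeCone P, (sub_zero f).symm⟩
  | zero => exact ⟨0, zero_mem_typeCone P, 0, zero_mem_typeCone P, (sub_zero 0).symm⟩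
  | add f f' _ _ ih ih' =>
    obtain ⟨g, hg, h, hh, rfl⟩ := ih
    obtain ⟨g', hg', h', hh', rfl⟩ := ih'
    exact ⟨_, add_mem_typeCone hg hg', _, add_mem_typeCone hh hh', by abel⟩
  | smul r f _ ih =>
    obtain ⟨g, hg, h, hh, rfl⟩ := ih
    rcases le_total 0 r with hr | hr
    · exact ⟨_, smul_mem_typeCone hg hr, _, smul_mem_typeCone hh hr, smul_sub _ _ _⟩
    · exact ⟨_, smul_mem_typeCone hh (neg_nonneg.2 hr), _, smul_mem_typeCone hg (neg_nonneg.2 hr),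
        by module⟩

theorem continuous_of_mem_typeSpace {P : Set (E d)} {f : E d → ℝ} (hf : f ∈ typeSpace P) :
    Continuous f := by
  obtain ⟨g, hg, h, hh, rfl⟩ := exists_sub_of_mem_typeSpace hf
  exact (continuous_of_mem_typeCone hg).sub (continuous_of_mem_typeCone hh)

theorem smul_of_mem_typeSpace {P : Set (E d)} {f : E d → ℝ} (hf : f ∈ typeSpace P) {c : ℝ}
    (hc : 0 ≤ c) (x : E d) : f (c • x) = c * f x := by
  obtain ⟨g, hg, h, hh, rfl⟩ := exists_sub_of_mem_typeSpace hf
  simp only [Pi.sub_apply, hg.1 c hc, hh.1 c hc, mul_sub]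

/-- Evaluation of the functions in the type space at a family of points. -/
def evalAt (P : Set (E d)) {ι : Type*} (u : ι → E d) : typeSpace P →ₗ[ℝ] (ι → ℝ) :=
  (LinearMap.funLeft ℝ ℝ u).comp (typeSpace P).subtype

/-- Evaluation at the finitely many rays is injective. -/
theorem finiteDimensional_typeSpace {P : Set (E d)} (hP : IsPolytope P)
    (hS : ∀ C ∈ normalFan P, IsSimplicialCone C) : FiniteDimensional ℝ (typeSpace P) := by
  obtain ⟨R, hR⟩ := exists_rays hP hS
  refine FiniteDimensional.of_injective (evalAt P (fun r : R => (r : E d))) ?_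
  rw [injective_iff_map_eq_zero]
  rintro ⟨f, hf⟩ h0
  ext u
  obtain ⟨k, v, c, hv, -, -, hlin⟩ := hR u
  obtain ⟨g, hg, h, hh, rfl⟩ := exists_sub_of_mem_typeSpace hf
  have hz (i : Fin k) : g (v i) - h (v i) = 0 := congrFun h0 ⟨v i, hv i⟩
  change g u - h u = 0
  rw [hlin g hg, hlin h hh, ← Finset.sum_sub_distrib]
  exact Finset.sum_eq_zero fun i _ => by rw [← mul_sub, hz, mul_zero]

/-! ### Least squares as projection onto a closed convex set -/

theorem exists_isMinOn_sum_sq {m : ℕ} {K : Set (Fin m → ℝ)} (hne : K.Nonempty)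
    (hK : IsClosed K) (y : Fin m → ℝ) :
    ∃ z ∈ K, IsMinOn (fun z => ∑ i, (z i - y i) ^ 2) K z := by
  -- The set is moved to `EuclideanSpace`, because `Fin m → ℝ` carries the sup metric.
  obtain ⟨z, hz, hmin⟩ := (hK.preimage (EuclideanSpace.equiv (Fin m) ℝ).continuous)
    |>.exists_infDist_eq_dist (by
      obtain ⟨z, hz⟩ := hne
      exact ⟨WithLp.toLp 2 z, hz⟩) (WithLp.toLp 2 y)
  refine ⟨z, hz, fun w hw => ?_⟩
  have h1 : dist (WithLp.toLp 2 y) z ≤ dist (WithLp.toLp 2 y) (WithLp.toLp 2 w) := by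
    rw [← hmin]
    exact Metric.infDist_le_dist_of_mem (show WithLp.toLp 2 w ∈ _ from hw)
  rw [dist_comm, dist_comm _ (WithLp.toLp 2 w), EuclideanSpace.dist_eq, EuclideanSpace.dist_eq,
    Real.sqrt_le_sqrt_iff (by positivity)] at h1
  simpa [Real.dist_eq, sq_abs] using h1

theorem eq_of_isMinOn_sum_sq {m : ℕ} {K : Set (Fin m → ℝ)} (hK : Convex ℝ K) {y z w : Fin m → ℝ}
    (hz : z ∈ K) (hw : w ∈ K) (hzmin : IsMinOn (fun z => ∑ i, (z i - y i) ^ 2) K z)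
    (hwmin : IsMinOn (fun z => ∑ i, (z i - y i) ^ 2) K w) : z = w := by
  have hmid := hK hz hw (by norm_num : (0 : ℝ) ≤ 1 / 2) (by norm_num : (0 : ℝ) ≤ 1 / 2)
    (by norm_num)
  have h1 := hzmin hmid
  have h2 := hwmin hmid
  simp only [Set.mem_ofPred_eq, Pi.add_apply, Pi.smul_apply, smul_eq_mul] at h1 h2
  -- Parallelogram identity: the midpoint would be strictly better if `z ≠ w`.
  have h3 : ∑ i, (1 / 2 * z i + 1 / 2 * w i - y i) ^ 2 = 1 / 2 * ∑ i, (z i - y i) ^ 2 +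
      1 / 2 * ∑ i, (w i - y i) ^ 2 - 1 / 4 * ∑ i, (z i - w i) ^ 2 := by
    simp only [Finset.mul_sum, ← Finset.sum_add_distrib, ← Finset.sum_sub_distrib]
    exact Finset.sum_congr rfl fun i _ => by ring
  have h4 : ∑ i, (z i - w i) ^ 2 = 0 :=
    le_antisymm (by linarith) (Finset.sum_nonneg fun i _ => sq_nonneg _)
  rw [Finset.sum_eq_zero_iff_of_nonneg fun i _ => sq_nonneg _] at h4
  funext i
  exact sub_eq_zero.1 (pow_eq_zero_iff two_ne_zero |>.1 (h4 i (Finset.mem_univ i)))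

theorem isMinOn_meanSquaredError_iff {m : ℕ} {D : Set (Set (E d))} (u : Fin m → E d)
    (y : Fin m → ℝ) (Q : Set (E d)) :
    IsMinOn (meanSquaredError u y) D Q ↔
      ∀ Q' ∈ D, ∑ i, (supportFun Q (u i) - y i) ^ 2 ≤ ∑ i, (supportFun Q' (u i) - y i) ^ 2 := by
  rcases Nat.eq_zero_or_pos m with rfl | hm
  · simp [isMinOn_iff, meanSquaredError]
  · have : (0 : ℝ) < 1 / m := by positivity
    simp only [isMinOn_iff, meanSquaredError, mul_le_mul_iff_right₀ this]

/-- The least-squares estimate is unique for all data iff the evaluation at the directions is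
injective on the type space. -/
theorem forall_encard_leastSquares_eq_one_iff {P : Set (E d)} (hP : IsPolytope P)
    (hS : ∀ C ∈ normalFan P, IsSimplicialCone C) {m : ℕ} (u : Fin m → E d) :
    (∀ y : Fin m → ℝ, (leastSquares (normalFan P) u y).encard = 1) ↔
      Function.Injective (evalAt P u) := by
  constructor
  · intro huniq
    rw [injective_iff_map_eq_zero]
    rintro ⟨f, hf⟩ h0
    obtain ⟨g, hg, h, hh, rfl⟩ := exists_sub_of_mem_typeSpace hf
    obtain ⟨Q, hQ, rfl⟩ := exists_supportFun_eq hP hS hg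
    obtain ⟨Q', hQ', rfl⟩ := exists_supportFun_eq hP hS hh
    -- With the measurements of `Q` as data, `Q` and `Q'` both have zero error, so uniqueness forces
    -- `Q = Q'`.
    obtain ⟨X, hX⟩ := Set.encard_eq_one.1 (huniq fun i => supportFun Q (u i))
    have hmem (A : Set (E d)) (hA : A ∈ deformationCone (normalFan P))
        (hAu : ∀ i, supportFun A (u i) = supportFun Q (u i)) : A = X := by
      rw [← Set.mem_singleton_iff, ← hX]
      refine ⟨hA, (isMinOn_meanSquaredError_iff _ _ _).2 fun B _ => ?_⟩
      simp only [hAu, sub_self]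
      exact Finset.sum_le_sum fun i _ => by simpa using sq_nonneg _
    have h1 := hmem Q hQ fun _ => rfl
    have h2 := hmem Q' hQ' fun i => (sub_eq_zero.1 (congrFun h0 i)).symm
    ext x
    simp [h1, h2]
  · intro hinj y
    have := finiteDimensional_typeSpace hP hS
    -- An injective linear map from a finite-dimensional space is a closed embedding; this makes the
    -- image of the cone closed.
    have hemb := (evalAt P u).isClosedEmbedding_of_injective (LinearMap.ker_eq_bot.2 hinj)
    set K : Set (typeSpace P) := Subtype.val ⁻¹' typeCone P
    have hKc : IsClosed K := (isClosed_typeCone P).preimage continuous_subtype_val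
    have hKconv : Convex ℝ K := (convex_typeCone P).linear_preimage (typeSpace P).subtype
    have hKne : K.Nonempty := ⟨0, zero_mem_typeCone P⟩
    have hIc : IsClosed (evalAt P u '' K) := hemb.isClosedMap K hKc
    have hmemK (Q : Set (E d)) (hQ : Q ∈ deformationCone (normalFan P)) :
        (fun i => supportFun Q (u i)) ∈ evalAt P u '' K :=
      ⟨⟨supportFun Q, Submodule.subset_span (supportFun_mem_typeCone hP hQ)⟩,
        supportFun_mem_typeCone hP hQ, rfl⟩
    have hmin (Q : Set (E d)) : IsMinOn (meanSquaredError u y) (deformationCone (normalFan P)) Q ↔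
        IsMinOn (fun z => ∑ i, (z i - y i) ^ 2) (evalAt P u '' K)
          (fun i => supportFun Q (u i)) := by
      rw [isMinOn_meanSquaredError_iff, isMinOn_iff]
      constructor
      · rintro h _ ⟨⟨f, _⟩, hfK, rfl⟩
        obtain ⟨Q', hQ', rfl⟩ := exists_supportFun_eq hP hS hfK
        exact h Q' hQ'
      · exact fun h Q' hQ' => h _ (hmemK Q' hQ')
    rw [Set.encard_eq_one]
    obtain ⟨_, ⟨⟨f, hf⟩, hfK, rfl⟩, hzmin⟩ := exists_isMinOn_sum_sq (hKne.image _) hIc y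
    obtain ⟨Q, hQ, rfl⟩ := exists_supportFun_eq hP hS hfK
    refine ⟨Q, Set.eq_singleton_iff_unique_mem.2 ⟨⟨hQ, (hmin Q).2 hzmin⟩, ?_⟩⟩
    rintro Q' ⟨hQ', hQ'min⟩
    have heq := eq_of_isMinOn_sum_sq (hKconv.linear_image (evalAt P u)) (hmemK Q' hQ')
      (hmemK Q hQ) ((hmin Q').1 hQ'min) hzmin
    have hsupp : supportFun Q' = supportFun Q := congrArg Subtype.val
      (@hinj ⟨supportFun Q', Submodule.subset_span (supportFun_mem_typeCone hP hQ')⟩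
        ⟨supportFun Q, Submodule.subset_span (supportFun_mem_typeCone hP hQ)⟩ heq)
    rw [hQ'.1.eq_setOf_inner_le_supportFun, hQ.1.eq_setOf_inner_le_supportFun, hsupp]

/-! ### Random directions: density, measurability and eventual injectivity -/

theorem isOpenPosMeasure_sphereUniform (d : ℕ) : (sphereUniform d).IsOpenPosMeasure := by
  refine ⟨fun U hU hne => ?_⟩
  rw [sphereUniform, Measure.smul_apply, smul_eq_mul]
  exact mul_ne_zero (ENNReal.inv_ne_zero.2 (measure_ne_top _ _)) (hU.measure_ne_zero _ hne)

/-- An event of positive probability is almost surely realized by a sequence of independent,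
identically distributed variables. -/
theorem ae_exists_mem_of_iIndepFun {Ω X : Type*} [MeasurableSpace Ω] [MeasurableSpace X]
    {μ : Measure Ω} [IsProbabilityMeasure μ] {ν : Measure X} {u : ℕ → Ω → X}
    (hmeas : ∀ i, Measurable (u i)) (hindep : iIndepFun u μ) (hlaw : ∀ i, μ.map (u i) = ν)
    {B : Set X} (hB : MeasurableSet B) (hpos : ν B ≠ 0) : ∀ᵐ ω ∂μ, ∃ i, u i ω ∈ B := by
  have : IsProbabilityMeasure ν := hlaw 0 ▸ Measure.isProbabilityMeasure_map (hmeas 0).aemeasurable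
  have hlt : ν Bᶜ < 1 := by
    rw [prob_compl_eq_one_sub hB]
    exact ENNReal.sub_lt_self ENNReal.one_ne_top one_ne_zero hpos
  -- Missing `B` forever implies missing it in the first `n` independent trials.
  have hle (n : ℕ) : μ {ω | ¬ ∃ i, u i ω ∈ B} ≤ ν Bᶜ ^ n := by
    calc μ {ω | ¬ ∃ i, u i ω ∈ B} ≤ μ (⋂ i ∈ Finset.range n, u i ⁻¹' Bᶜ) := by
          refine measure_mono fun ω hω => ?_
          simp only [Set.mem_iInter]
          exact fun i _ hi => hω ⟨i, hi⟩
      _ = ∏ i ∈ Finset.range n, μ (u i ⁻¹' Bᶜ) :=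
          hindep.measure_inter_preimage_eq_mul _ fun _ _ => hB.compl
      _ = ν Bᶜ ^ n := by
          rw [Finset.prod_congr rfl fun i _ => by
            rw [← Measure.map_apply (hmeas i) hB.compl, hlaw i], Finset.prod_const,
            Finset.card_range]
  exact le_antisymm (ge_of_tendsto' (ENNReal.tendsto_pow_atTop_nhds_zero_of_lt_one hlt) hle) zero_le

theorem ae_denseRange_of_iIndepFun {Ω X : Type*} [MeasurableSpace Ω] [TopologicalSpace X]
    [SecondCountableTopology X] [MeasurableSpace X] [OpensMeasurableSpace X]
    {μ : Measure Ω} [IsProbabilityMeasure μ] {ν : Measure X} [ν.IsOpenPosMeasure] {u : ℕ → Ω → X}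
    (hmeas : ∀ i, Measurable (u i)) (hindep : iIndepFun u μ) (hlaw : ∀ i, μ.map (u i) = ν) :
    ∀ᵐ ω ∂μ, DenseRange fun i => u i ω := by
  have hb := TopologicalSpace.isBasis_countableBasis X
  have hall : ∀ᵐ ω ∂μ, ∀ B ∈ TopologicalSpace.countableBasis X, B.Nonempty → ∃ i, u i ω ∈ B := by
    rw [ae_ball_iff (TopologicalSpace.countable_countableBasis X)]
    intro B hB
    by_cases hne : B.Nonempty
    · filter_upwards [ae_exists_mem_of_iIndepFun hmeas hindep hlaw (hb.isOpen hB).measurableSet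
        ((hb.isOpen hB).measure_ne_zero ν hne)] with ω hω _ using hω
    · exact Eventually.of_forall fun ω h => absurd h hne
  filter_upwards [hall] with ω hω
  refine hb.dense_iff.2 fun B hB hne => ?_
  obtain ⟨i, hi⟩ := hω B hB hne
  exact ⟨_, hi, i, rfl⟩

/-- Injectivity says that the evaluation vectors of a basis are linearly independent, an open
condition on vectors that depend measurably on `ω`. -/
theorem measurableSet_injective_evalAt {P : Set (E d)} [FiniteDimensional ℝ (typeSpace P)]
    {Ω : Type*} [MeasurableSpace Ω] {m : ℕ} {u : Fin m → Ω → E d} (hu : ∀ i, Measurable (u i)) :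
    MeasurableSet {ω | Function.Injective (evalAt P fun i => u i ω)} := by
  set b := Module.finBasis ℝ (typeSpace P)
  have hiff (ω : Ω) : Function.Injective (evalAt P fun i => u i ω) ↔
      LinearIndependent ℝ fun j => evalAt P (fun i => u i ω) (b j) := by
    constructor
    · intro h
      exact b.linearIndependent.map' _ (LinearMap.ker_eq_bot.2 h)
    · intro h
      rw [injective_iff_map_eq_zero]
      intro f hf
      rw [← b.sum_repr f, map_sum] at hf
      simp only [map_smul] at hf
      have := Fintype.linearIndependent_iff.1 h _ hf
      rw [← b.sum_repr f]
      simp [this]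
  simp only [hiff]
  have hmeas : Measurable fun ω j => evalAt P (fun i => u i ω) (b j) :=
    measurable_pi_lambda _ fun j => measurable_pi_lambda _ fun i =>
      (continuous_of_mem_typeSpace (b j).2).measurable.comp (hu i)
  exact hmeas (isOpen_setOfPred_linearIndependent (𝕜 := ℝ) (E := Fin m → ℝ)).measurableSet

theorem injective_evalAt_mono {P : Set (E d)} {u : ℕ → E d} {m n : ℕ} (hmn : m ≤ n)
    (h : Function.Injective (evalAt P fun i : Fin m => u i)) :
    Function.Injective (evalAt P fun i : Fin n => u i) :=
  fun _ _ hfg => h (funext fun i => congrFun hfg (Fin.castLE hmn i))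

/-- Along a dense sequence of directions, evaluation is eventually injective on the type space. -/
theorem exists_injective_evalAt {P : Set (E d)} [FiniteDimensional ℝ (typeSpace P)]
    {u : ℕ → Metric.sphere (0 : E d) 1} (hu : DenseRange u) :
    ∃ m : ℕ, Function.Injective (evalAt P fun i : Fin m => (u i : E d)) := by
  have hanti : ∀ m n : ℕ, m ≤ n → LinearMap.ker (evalAt P fun i : Fin n => (u i : E d)) ≤
      LinearMap.ker (evalAt P fun i : Fin m => (u i : E d)) := fun m n hmn f hf => by
    rw [LinearMap.mem_ker] at hf ⊢
    exact funext fun i => congrFun hf (Fin.castLE hmn i)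
  obtain ⟨m, hm⟩ := IsArtinian.monotone_stabilizes
    (⟨fun m => OrderDual.toDual (LinearMap.ker (evalAt P fun i : Fin m => (u i : E d))),
      fun m n hmn => hanti m n hmn⟩ : ℕ →o (Submodule ℝ (typeSpace P))ᵒᵈ)
  refine ⟨m, (injective_iff_map_eq_zero _).2 fun f hf => ?_⟩
  have hzero (i : ℕ) : (f : E d → ℝ) (u i) = 0 := by
    -- The stage `max m (i + 1)` is past stabilization and includes direction `i`.
    have hker : f ∈ LinearMap.ker (evalAt P fun j : Fin (max m (i + 1)) => (u j : E d)) := by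
      have h := hm (max m (i + 1)) (le_max_left _ _)
      have h' : LinearMap.ker (evalAt P fun i : Fin m => (u i : E d)) =
        LinearMap.ker (evalAt P fun j : Fin (max m (i + 1)) => (u j : E d)) := h
      rw [← h']
      exact hf
    exact congrFun (LinearMap.mem_ker.1 hker) ⟨i, (Nat.lt_succ_self i).trans_le (le_max_right _ _)⟩
  have hsphere (s : Metric.sphere (0 : E d) 1) : (f : E d → ℝ) s = 0 :=
    congrFun (hu.equalizer ((continuous_of_mem_typeSpace f.2).comp continuous_subtype_val)
      (continuous_const (y := (0 : ℝ))) (funext hzero)) s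
  ext x
  by_cases hx : x = 0
  · simpa [hx] using smul_of_mem_typeSpace f.2 le_rfl (0 : E d)
  · have hn : ‖x‖ ≠ 0 := norm_ne_zero_iff.2 hx
    have h1 := hsphere ⟨‖x‖⁻¹ • x, by simp [norm_smul, hn]⟩
    have h2 := smul_of_mem_typeSpace f.2 (norm_nonneg x) (‖x‖⁻¹ • x)
    rw [smul_inv_smul₀ hn] at h2
    simpa [h1] using h2

end PolytopeReconstruction

open PolytopeReconstruction
-- The limit of the probabilities
theorem proposition4p1 (d : ℕ) (hd : 1 ≤ d)
    (Δ : Set (Set (E d))) (hΔ : IsSimplicialPolytopalFan Δ)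
    {Ω : Type*} [MeasurableSpace Ω] (μ : Measure Ω) [IsProbabilityMeasure μ]
    (u : ℕ → Ω → Metric.sphere (0 : E d) 1)
    (hmeas : ∀ i, Measurable (u i))
    (hindep : iIndepFun u μ)
    (hunif : ∀ i, μ.map (u i) = sphereUniform d) :
    (∀ m : ℕ, MeasurableSet (uniqueEvent Δ u m)) ∧
      Tendsto (fun m : ℕ => μ (uniqueEvent Δ u m)) atTop (𝓝 1) := by
  obtain ⟨⟨P, hP, rfl⟩, hS⟩ := hΔ
  have := finiteDimensional_typeSpace hP hS
  have hev (m : ℕ) : uniqueEvent (normalFan P) u m =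
      {ω | Function.Injective (evalAt P fun i : Fin m => (u i ω : E d))} :=
    Set.ext fun ω => forall_encard_leastSquares_eq_one_iff hP hS _
  have hms (m : ℕ) : MeasurableSet (uniqueEvent (normalFan P) u m) := by
    rw [hev]
    exact measurableSet_injective_evalAt fun i => measurable_subtype_coe.comp (hmeas i)
  refine ⟨hms, ?_⟩
  have hmono : Monotone (uniqueEvent (normalFan P) u) := fun m n hmn ω hω => by
    rw [hev] at hω ⊢
    exact injective_evalAt_mono (u := fun i => (u i ω : E d)) hmn hω
  have hone : μ (⋃ m, uniqueEvent (normalFan P) u m) = 1 := by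
    have hpos := isOpenPosMeasure_sphereUniform d
    rw [← mem_ae_iff_prob_eq_one (MeasurableSet.iUnion hms)]
    filter_upwards [ae_denseRange_of_iIndepFun hmeas hindep hunif] with ω hω
    obtain ⟨m, hm⟩ := exists_injective_evalAt (P := P) hω
    exact Set.mem_iUnion.2 ⟨m, by rw [hev]; exact hm⟩
  rw [← hone]
  exact tendsto_measure_iUnion_atTop hmono
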